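/- Let $K$ be a field, $V$ a $K$-vector space of finite dimension $\ell$, and $\Delta=(\alpha_1,\dots,\alpha_n)$ a finite sequence of linear forms spanning $V^*$ (zero forms and repeated or proportional forms are allowed). Let $E=\{1,\dots,n\}$ and let $M(\Delta)$ be the matroid on $E$ in which a set $I$ is independent iff $(\alpha_i)_{i\in I}$ is linearly independent. Write $r$ for the rank function of $M(\Delta)$ and $$T(M(\Delta);x,y)=\sum_{A\subseteq E}(x-1)^{r(E)-r(A)}(y-1)^{|A|-r(A)}\in\mathbb Z[x,y]$$ for its Tutte polynomial. For $S\subseteq E$ put $\alpha_S=\prod_{i\in S}\alpha_i\in\operatorname{Sym}(V^*)$, and let $P(\Delta)_{j,k}$ be the $K$-subspace of $\operatorname{Sym}(V^*)$ spanned by those $\alpha_S$ for which $\{\alpha_i : i\in E\setminus S\}$ spans a $j$-dimensional subspace of $V^*$ and $|E\setminus S|=k$. (These spaces vanish for $j>\ell$.) Then, in $\mathbb Z[x,y]$, $$T(M(\Delta);x,y)=\sum_{0\le j\le k\le n}(x-1)^{\ell-j}\,y^{k-j}\,\dim_K P(\Delta)_{j,k}.$$ Equivalently, the bigraded Hilbert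 series of the spaces $P(\Delta)_{j,k}$ satisfies $$\sum_{0\le j\le k\le n}x^{\ell-j}\,y^{k-j}\,\dim_K P(\Delta)_{j,k}=T(M(\Delta);1+x,y).$$ -/

import Mathlib

open MvPolynomial

namespace VectorConfiguration

/-- Augmentation for linearly independent subfamilies of a finite family of vectors. -/
theorem linearIndepOn_augment {ι K W : Type*} [Finite ι] [Field K] [AddCommGroup W] [Module K W]
    (v : ι → W) {I J : Set ι} (hI : LinearIndepOn K v I) (hJ : LinearIndepOn K v J)
    (hIJ : I.ncard < J.ncard) : ∃ e ∈ J, e ∉ I ∧ LinearIndepOn K v (insert e I) := by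
  by_contra! hcon
  have hmem : ∀ e ∈ J, v e ∈ Submodule.span K (v '' I) := by
    intro e he
    by_cases heI : e ∈ I
    · exact Submodule.subset_span ⟨e, heI, rfl⟩
    · by_contra hn
      exact hcon e he heI (hI.insert hn)
  have hle : Submodule.span K (v '' J) ≤ Submodule.span K (v '' I) := by
    rw [Submodule.span_le]
    rintro _ ⟨e, he, rfl⟩
    exact hmem e he
  have hcard : ∀ S : Set ι, LinearIndepOn K v S →
      Module.finrank K (Submodule.span K (v '' S)) = S.ncard := by
    intro S hS
    have : Fintype S := Fintype.ofFinite S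
    have h := finrank_span_eq_card (R := K) (b := fun x : S => v x) hS
    rw [Set.image_eq_range, h, ← Nat.card_eq_fintype_card, Nat.card_coe_set_eq]
  have : FiniteDimensional K (Submodule.span K (v '' I)) :=
    FiniteDimensional.span_of_finite K ((Set.toFinite I).image v)
  have := Submodule.finrank_mono hle
  rw [hcard I hI, hcard J hJ] at this
  omega

/-- The matroid `M(Δ)` represented by a finite family of vectors `v`: its ground set is the whole
index set, and a set of indices is independent iff the corresponding subfamily is linearly
independent. -/
def matroid (K : Type*) {ι W : Type*} [Finite ι] [Field K] [AddCommGroup W] [Module K W]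
    (v : ι → W) : Matroid ι :=
  (IndepMatroid.ofFinite (E := Set.univ) Set.finite_univ (fun I => LinearIndepOn K v I)
    (linearIndepOn_empty K v)
    (fun _ _ hJ hIJ => hJ.mono hIJ)
    (fun _ _ hI hJ hIJ => linearIndepOn_augment v hI hJ hIJ)
    (fun _ _ => Set.subset_univ _)).matroid

instance matroid_finite (K : Type*) {ι W : Type*} [Finite ι] [Field K] [AddCommGroup W]
    [Module K W] (v : ι → W) : (matroid K v).Finite :=
  ⟨Set.toFinite _⟩

/-- The Tutte polynomial of a finite matroid,
`T(M; x, y) = ∑_{A ⊆ E} (x - 1) ^ (r(E) - r(A)) * (y - 1) ^ (|A| - r(A))`,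
as an element of `ℤ[x, y]` with `x = X 0` and `y = X 1`. -/
noncomputable def tuttePolynomial {ι : Type*} (M : Matroid ι) [M.Finite] :
    MvPolynomial (Fin 2) ℤ :=
  ∑ A ∈ M.ground_finite.toFinset.powerset,
    (X 0 - 1) ^ (M.eRank.toNat - (M.eRk (A : Set ι)).toNat) *
      (X 1 - 1) ^ (A.card - (M.eRk (A : Set ι)).toNat)

variable {K V : Type*} [Field K] [AddCommGroup V] [Module K V] {n : ℕ}

/-- The product `α_S = ∏_{i ∈ S} α_i` in `Sym(V*)`. -/
noncomputable def prodForms (Δ : Fin n → Module.Dual K V) (S : Finset (Fin n)) :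
    SymmetricAlgebra K (Module.Dual K V) :=
  ∏ i ∈ S, SymmetricAlgebra.ι K (Module.Dual K V) (Δ i)

/-- The subspace `P(Δ)_{j,k}` of `Sym(V*)` spanned by the products `α_S` for which
`{α_i : i ∈ E - S}` spans a `j`-dimensional subspace of `V*` and `|E - S| = k`. -/
noncomputable def piece (Δ : Fin n → Module.Dual K V) (j k : ℕ) :
    Submodule K (SymmetricAlgebra K (Module.Dual K V)) :=
  Submodule.span K
    {f | ∃ S : Finset (Fin n),
      Module.finrank K (Submodule.span K (Δ '' ((Sᶜ : Finset (Fin n)) : Set (Fin n)))) = j ∧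
      (Sᶜ).card = k ∧ f = prodForms Δ S}

/-- The bigraded Hilbert series `∑_{0 ≤ j ≤ k ≤ n} x ^ (ℓ - j) * y ^ (k - j) * dim P(Δ)_{j,k}`,
where `ℓ = dim V`, as an element of `ℤ[x, y]` with `x = X 0` and `y = X 1`.
(For `j > ℓ` the space `P(Δ)_{j,k}` is zero, so truncation of `ℓ - j` plays no role.) -/
noncomputable def hilbertSeries (Δ : Fin n → Module.Dual K V) : MvPolynomial (Fin 2) ℤ :=
  ∑ k ∈ Finset.range (n + 1), ∑ j ∈ Finset.range (k + 1),
    X 0 ^ (Module.finrank K V - j) * X 1 ^ (k - j) *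
      (Module.finrank K (piece Δ j k) : MvPolynomial (Fin 2) ℤ)

end VectorConfiguration

/-!
The spaces `P(Δ)_{j,k}` have an explicit basis. Order the index set and call `T` prefix-closed if it
contains every index `e` for which `α_e` lies in the span of the `α_i` with `i ∈ T` and `i < e`;
a loop, for instance, lies in every prefix-closed set. The products `α_{E - T}`, with `T`
prefix-closed of rank `j` and size `k`, form a basis of `P(Δ)_{j,k}`.

They span (`prod_mem_span_prefixClosed`) by straightening: if `e ∉ T` and `α_e = ∑ c_i α_i` over
smaller `i ∈ T`, then substituting for the factor `α_e` of `α_{E - T}` exchanges elements of `T` for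
the larger `e` and keeps size and span of `T`.

They are independent (`linearIndepOn_prod_prefixClosed`), even for all `j` and `k` at once, by
deletion and contraction of the least index `a`. The prefix-closed sets containing `a` are those of
the contraction with `a` added, and the others, which exist only if `a` is not a loop, are those of
the deletion. A relation maps to `Sym` of the quotient by `α_a`, where only the first kind survives;
a relation among the second kind is `α_a` times a relation for the deletion.

The Tutte polynomial counts the same sets (`sum_powerset_eq_sum_prefixClosed`): by the same
deletion and contraction, `∑_A φ(r(A)) (y - 1) ^ (|A| - r(A))` equals the sum of
`φ(r(T)) y ^ (|T| - r(T))` over prefix-closed `T`, for every weight `φ` of the rank.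
-/

namespace VectorConfiguration

open Module Submodule

/-! ### Rank and contraction of vector configurations -/

section Configurations

variable {ι : Type*} (K : Type*) [Field K]

/-- The rank of the subfamily of `v` indexed by `A`. -/
noncomputable def rk {W : Type*} [AddCommGroup W] [Module K W] (v : ι → W) (A : Finset ι) : ℕ :=
  finrank K (span K (v '' (A : Set ι)))

theorem rk_le_card {W : Type*} [AddCommGroup W] [Module K W] (v : ι → W) (A : Finset ι) :
    rk K v A ≤ A.card := by
  classical
  have h := finrank_span_finset_le_card (R := K) (A.image v)
  rw [Set.finrank, Finset.coe_image] at h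
  exact h.trans Finset.card_image_le

/-- Contraction at `a`: the configuration of images of `v` in the quotient by the line of `v a`. -/
def contract {W : Type*} [AddCommGroup W] [Module K W] (v : ι → W) (a : ι) :
    ι → W ⧸ span K {v a} :=
  fun i => (span K {v a}).mkQ (v i)

variable {K}

theorem span_contract {W : Type*} [AddCommGroup W] [Module K W] (v : ι → W) (a : ι) (A : Set ι) :
    span K (contract K v a '' A) = (span K (v '' A)).map (span K {v a}).mkQ := by
  rw [map_span, Set.image_image]
  rfl

theorem contract_mem_span_iff {W : Type*} [AddCommGroup W] [Module K W] (v : ι → W) (a e : ι)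
    (A : Set ι) :
    contract K v a e ∈ span K (contract K v a '' A) ↔ v e ∈ span K (v '' insert a A) := by
  rw [span_contract, Set.image_insert_eq, span_insert, ← comap_map_mkQ]
  rfl

theorem rk_insert_of_eq_zero [DecidableEq ι] {W : Type*} [AddCommGroup W] [Module K W] {v : ι → W}
    {a : ι} (h : v a = 0) (A : Finset ι) : rk K v (insert a A) = rk K v A := by
  rw [rk, Finset.coe_insert, Set.image_insert_eq, h, span_insert_zero, rk]

theorem rk_insert_of_ne_zero [DecidableEq ι] {W : Type*} [AddCommGroup W] [Module K W] {v : ι → W}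
    {a : ι} (h : v a ≠ 0) (A : Finset ι) :
    rk K v (insert a A) = rk K (contract K v a) A + 1 := by
  set p := span K {v a} with hp
  have hP : span K (v '' (insert a A : Finset ι)) = p ⊔ span K (v '' (A : Set ι)) := by
    rw [Finset.coe_insert, Set.image_insert_eq, span_insert]
  set P := span K (v '' (insert a A : Finset ι)) with hPdef
  have hle : p ≤ P := hP ▸ le_sup_left
  have : FiniteDimensional K P :=
    FiniteDimensional.span_of_finite K ((Finset.finite_toSet _).image v)
  have h1 := LinearMap.finrank_range_add_finrank_ker (p.mkQ.domRestrict P)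
  have h2 : LinearMap.range (p.mkQ.domRestrict P) = span K (contract K v a '' (A : Set ι)) := by
    rw [LinearMap.range_domRestrict, span_contract, hP, Submodule.map_sup, mkQ_map_self,
      bot_sup_eq]
  have h3 : finrank K (LinearMap.ker (p.mkQ.domRestrict P)) = 1 := by
    rw [LinearMap.ker_domRestrict, ker_mkQ]
    exact (submoduleOfEquivOfLe hle).finrank_eq.trans (finrank_span_singleton h)
  rw [h2, h3] at h1
  exact h1.symm

end Configurations

/-! ### Prefix-closed sets and the Tutte polynomial -/

section PrefixClosed

variable {ι : Type*} [LinearOrder ι] (K : Type*) [Field K]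

/-- A set `T` of indices is *prefix-closed* in `E` if it contains every `e ∈ E` for which `v e` lies
in the span of the `v i` with `i ∈ T` and `i < e`. -/
def PrefixClosed {W : Type*} [AddCommGroup W] [Module K W] (v : ι → W) (E T : Finset ι) : Prop :=
  ∀ e ∈ E, v e ∈ span K (v '' {i | i ∈ T ∧ i < e}) → e ∈ T

variable {K}

theorem prefixClosed_insert_iff {W : Type*} [AddCommGroup W] [Module K W] {v : ι → W} {a : ι}
    {E T : Finset ι} (ha : ∀ x ∈ E, a < x) (hT : T ⊆ E) :
    PrefixClosed K v (insert a E) T ↔ v a ≠ 0 ∧ PrefixClosed K v E T := by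
  have haT : a ∉ T := fun h => lt_irrefl a (ha a (hT h))
  have hempty : {i | i ∈ T ∧ i < a} = ∅ := by
    ext i
    simp only [Set.mem_ofPred_eq, Set.mem_empty_iff_false, iff_false, not_and, not_lt]
    exact fun hi => (ha i (hT hi)).le
  simp [PrefixClosed, hempty, haT]

theorem prefixClosed_insert_insert_iff {W : Type*} [AddCommGroup W] [Module K W] {v : ι → W}
    {a : ι} {E T : Finset ι} (ha : ∀ x ∈ E, a < x) :
    PrefixClosed K v (insert a E) (insert a T) ↔ PrefixClosed K (contract K v a) E T := by
  rw [PrefixClosed, Finset.forall_mem_insert]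
  simp only [Finset.mem_insert_self, implies_true, true_and]
  refine forall₂_congr fun e he => ?_
  have hset : {i | i ∈ insert a T ∧ i < e} = insert a {i | i ∈ T ∧ i < e} := by
    ext i
    have := ha e he
    simp only [Finset.mem_insert, Set.mem_ofPred_eq, Set.mem_insert_iff]
    grind
  rw [contract_mem_span_iff, hset, Finset.mem_insert, or_iff_right (ha e he).ne']

theorem prefixClosed_contract_of_eq_zero {W : Type*} [AddCommGroup W] [Module K W] {v : ι → W}
    {a : ι} (h : v a = 0) (E T : Finset ι) :
    PrefixClosed K (contract K v a) E T ↔ PrefixClosed K v E T := by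
  refine forall₂_congr fun e _ => ?_
  rw [contract_mem_span_iff, Set.image_insert_eq, h, span_insert_zero]

open Classical in
/-- Every set `A` lies in exactly one interval `[I, T]` with `T` prefix-closed and `I` its greedy
basis; the rank is constant on the interval, and the binomial theorem sums `(y - 1) ^ (|A| - r)`
over it to `y ^ (|T| - r)`. The induction removes the least index, and the weight `φ`, arbitrary so
that it can absorb the shift of the rank under contraction, avoids truncated coranks. -/
theorem sum_powerset_eq_sum_prefixClosed {R : Type*} [CommRing R] (y : R) (E : Finset ι)
    {W : Type*} [AddCommGroup W] [Module K W] (v : ι → W) (φ : ℕ → R) :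
    ∑ A ∈ E.powerset, φ (rk K v A) * (y - 1) ^ (A.card - rk K v A) =
      ∑ T ∈ E.powerset with PrefixClosed K v E T, φ (rk K v T) * y ^ (T.card - rk K v T) := by
  induction E using Finset.induction_on_min generalizing W φ with
  | empty => simp [PrefixClosed, rk]
  | insert a E ha ih =>
    have haE : a ∉ E := fun h => lt_irrefl a (ha a h)
    rw [Finset.sum_filter, Finset.sum_powerset_insert haE, Finset.sum_powerset_insert haE]
    have hcard : ∀ A ∈ E.powerset, (insert a A).card = A.card + 1 := fun A hA =>
      Finset.card_insert_of_notMem fun h => haE (Finset.mem_powerset.1 hA h)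
    have hclosed : ∀ T ∈ E.powerset,
        (PrefixClosed K v (insert a E) T ↔ v a ≠ 0 ∧ PrefixClosed K v E T) := fun T hT =>
      prefixClosed_insert_iff ha (Finset.mem_powerset.1 hT)
    by_cases h : v a = 0
    · have hzero : ∑ T ∈ E.powerset, (if PrefixClosed K v (insert a E) T then
          φ (rk K v T) * y ^ (T.card - rk K v T) else 0) = 0 :=
        Finset.sum_eq_zero fun T hT => if_neg fun hc => ((hclosed T hT).1 hc).1 h
      have hA : ∀ (z : R), ∀ A ∈ E.powerset, φ (rk K v (insert a A)) *
          z ^ ((insert a A).card - rk K v (insert a A)) =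
            z * (φ (rk K v A) * z ^ (A.card - rk K v A)) := by
        intro z A hA
        rw [rk_insert_of_eq_zero h, hcard A hA, Nat.sub_add_comm (rk_le_card K v A), pow_succ]
        ring
      have hT : ∀ T ∈ E.powerset, (if PrefixClosed K v (insert a E) (insert a T) then
          φ (rk K v (insert a T)) * y ^ ((insert a T).card - rk K v (insert a T)) else 0) =
            y * if PrefixClosed K v E T then φ (rk K v T) * y ^ (T.card - rk K v T) else 0 := by
        intro T hT
        rw [hA y T hT, mul_ite, mul_zero]
        simp only [prefixClosed_insert_insert_iff ha, prefixClosed_contract_of_eq_zero h]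
      rw [hzero, zero_add, Finset.sum_congr rfl (hA (y - 1)), Finset.sum_congr rfl hT,
        ← Finset.mul_sum, ← Finset.mul_sum, ← Finset.sum_filter, ← ih v φ]
      ring
    · rw [ih v φ, Finset.sum_filter]
      congr 1
      · exact Finset.sum_congr rfl fun T hT => by simp only [hclosed T hT, h, ne_eq,
          not_false_eq_true, true_and]
      · have hA : ∀ (z : R), ∀ A ∈ E.powerset, φ (rk K v (insert a A)) *
            z ^ ((insert a A).card - rk K v (insert a A)) =
              φ (rk K (contract K v a) A + 1) * z ^ (A.card - rk K (contract K v a) A) := by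
          intro z A hA
          rw [rk_insert_of_ne_zero h, hcard A hA, Nat.add_sub_add_right]
        rw [Finset.sum_congr rfl (hA (y - 1)), ih (contract K v a) fun m => φ (m + 1),
          Finset.sum_filter]
        exact Finset.sum_congr rfl fun T hT => by
          simp only [prefixClosed_insert_insert_iff ha, hA y T hT]

end PrefixClosed

/-! ### The basis of products of forms -/

section Products

variable {ι : Type*} [LinearOrder ι] {K : Type*} [Field K]

theorem symmetricAlgebra_ι_ne_zero {W : Type*} [AddCommGroup W] [Module K W] {w : W} (h : w ≠ 0) :
    SymmetricAlgebra.ι K W w ≠ 0 := by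
  intro h0
  refine h ((forall_dual_apply_eq_zero_iff K w).1 fun f => ?_)
  rw [← SymmetricAlgebra.lift_ι_apply f w, h0, map_zero]

open Classical in
/-- The products of the complements of prefix-closed sets are linearly independent. Setting the form
with the least index `a` to zero kills the products with `a ∉ T` and leaves those of the
contraction; the remaining relation is divisible by that form, and `Sym W` is a domain. -/
theorem linearIndepOn_prod_prefixClosed (E : Finset ι) {W : Type*} [AddCommGroup W] [Module K W]
    (v : ι → W) :
    LinearIndepOn K (fun T : Finset ι => ∏ i ∈ E \ T, SymmetricAlgebra.ι K W (v i))
      ({T ∈ E.powerset | PrefixClosed K v E T} : Finset (Finset ι)) := by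
  induction E using Finset.induction_on_min generalizing W with
  | empty =>
    rw [linearIndepOn_finset_iff]
    intro g hg T hT
    obtain rfl : T = ∅ := by simpa using (Finset.mem_filter.1 hT).1
    simpa [PrefixClosed, Finset.filter_singleton] using hg
  | insert a E ha ih =>
    have haE : a ∉ E := fun h => lt_irrefl a (ha a h)
    rw [linearIndepOn_finset_iff]
    intro g hg
    have hprod : ∀ T ∈ E.powerset, ∏ i ∈ insert a E \ T, SymmetricAlgebra.ι K W (v i) =
        SymmetricAlgebra.ι K W (v a) * ∏ i ∈ E \ T, SymmetricAlgebra.ι K W (v i) := by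
      intro T hT
      rw [Finset.insert_sdiff_of_notMem _ fun h => haE (Finset.mem_powerset.1 hT h),
        Finset.prod_insert fun h => haE (Finset.mem_sdiff.1 h).1]
    have hprod' : ∀ T : Finset ι, insert a E \ insert a T = E \ T := by
      intro T
      ext i
      simp only [Finset.mem_sdiff, Finset.mem_insert]
      grind
    rw [Finset.sum_filter, Finset.sum_powerset_insert haE] at hg
    simp only [hprod', prefixClosed_insert_insert_iff ha] at hg
    set F := SymmetricAlgebra.lift
      (SymmetricAlgebra.ι K (W ⧸ span K {v a}) ∘ₗ (span K {v a}).mkQ) with hF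
    have hFι : ∀ i, F (SymmetricAlgebra.ι K W (v i)) =
        SymmetricAlgebra.ι K (W ⧸ span K {v a}) (contract K v a i) := fun i => by
      rw [hF, SymmetricAlgebra.lift_ι_apply]
      rfl
    have hFa : F (SymmetricAlgebra.ι K W (v a)) = 0 := by
      have : contract K v a a = 0 := by
        simp [contract, mem_span_singleton_self]
      rw [hFι, this, map_zero]
    -- The image of the relation under `F : Sym W → Sym (W / ⟨v a⟩)` is a relation of the contraction.
    have hcontr : ∀ T ∈ ({T ∈ E.powerset | PrefixClosed K (contract K v a) E T} :
        Finset (Finset ι)), g (insert a T) = 0 := by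
      refine linearIndepOn_finset_iff.1 (ih (contract K v a)) (fun T => g (insert a T)) ?_
      have h := congrArg F hg
      rw [map_add, map_sum, map_sum, map_zero, Finset.sum_eq_zero, zero_add] at h
      · rw [Finset.sum_filter]
        refine Eq.trans ?_ h
        refine Finset.sum_congr rfl fun T _ => ?_
        rw [apply_ite F, map_smul, map_prod, map_zero F]
        simp only [hFι]
      · intro T hT
        rw [hprod T hT, apply_ite F, map_smul, map_mul, hFa, zero_mul, smul_zero, map_zero, ite_self]
    -- What remains is `v a` times a relation among the products of the family on `E`.
    have hdel : ∀ T ∈ E.powerset, PrefixClosed K v (insert a E) T → g T = 0 := by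
      intro T hT hc
      obtain ⟨h, hc⟩ := (prefixClosed_insert_iff ha (Finset.mem_powerset.1 hT)).1 hc
      refine linearIndepOn_finset_iff.1 (ih v) g ?_ T (Finset.mem_filter.2 ⟨hT, hc⟩)
      have hne := symmetricAlgebra_ι_ne_zero (K := K) h
      refine (mul_eq_zero.1 ?_).resolve_left hne
      rw [← hg, Finset.sum_eq_zero (s := E.powerset)
        (f := fun T => if PrefixClosed K (contract K v a) E T then _ else _), add_zero,
        Finset.mul_sum, Finset.sum_filter]
      · refine Finset.sum_congr rfl fun S hS => ?_
        rw [hprod S hS, mul_smul_comm]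
        simp only [prefixClosed_insert_iff ha (Finset.mem_powerset.1 hS), h, ne_eq,
          not_false_eq_true, true_and]
      · intro S hS
        split_ifs with hSc
        · rw [hcontr S (Finset.mem_filter.2 ⟨hS, hSc⟩), zero_smul]
        · rfl
    intro T hT
    rw [Finset.mem_filter, Finset.mem_powerset] at hT
    by_cases haT : a ∈ T
    · have hTe : insert a (T.erase a) = T := Finset.insert_erase haT
      rw [← hTe]
      refine hcontr _ (Finset.mem_filter.2 ⟨Finset.mem_powerset.2 ?_, ?_⟩)
      · exact Finset.subset_insert_iff.1 hT.1
      · rw [← prefixClosed_insert_insert_iff ha, hTe]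
        exact hT.2
    · exact hdel T (Finset.mem_powerset.2 ((Finset.subset_insert_iff_of_notMem haT).1 hT.1)) hT.2

/-- Exchanging `i ∈ T` for `e ∉ T` does not change the span when `v e` is a combination of the
subfamily `T` in which `v i` occurs. -/
theorem span_image_insert_erase {W : Type*} [AddCommGroup W] [Module K W] (v : ι → W)
    {S T : Finset ι} (hST : S ⊆ T) {e i : ι} {c : ι → K} (hc : ∑ j ∈ S, c j • v j = v e)
    (hi : i ∈ S) (hci : c i ≠ 0) :
    span K (v '' (insert e (T.erase i) : Finset ι)) = span K (v '' (T : Set ι)) := by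
  apply le_antisymm
  · rw [span_le]
    rintro _ ⟨j, hj, rfl⟩
    rcases Finset.mem_insert.1 hj with rfl | hj
    · rw [← hc]
      exact sum_mem fun k hk => smul_mem _ _ (subset_span ⟨k, hST hk, rfl⟩)
    · exact subset_span ⟨j, Finset.mem_of_mem_erase hj, rfl⟩
  · rw [span_le]
    rintro _ ⟨j, hj, rfl⟩
    have hmem : ∀ k ∈ T, k ≠ i → v k ∈ span K (v '' (insert e (T.erase i) : Finset ι)) :=
      fun k hk hki => subset_span
        ⟨k, Finset.mem_insert_of_mem (Finset.mem_erase.2 ⟨hki, hk⟩), rfl⟩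
    by_cases hji : j = i
    · subst hji
      rw [← Finset.add_sum_erase S _ hi] at hc
      have hv : v j = (c j)⁻¹ • (v e - ∑ k ∈ S.erase j, c k • v k) := by
        rw [← hc, add_sub_cancel_right, smul_smul, inv_mul_cancel₀ hci, one_smul]
      rw [SetLike.mem_coe, hv]
      refine smul_mem _ _ (sub_mem (subset_span ⟨e, Finset.mem_insert_self _ _, rfl⟩) ?_)
      exact sum_mem fun k hk => smul_mem _ _
        (hmem k (hST (Finset.mem_of_mem_erase hk)) (Finset.ne_of_mem_erase hk))
    · exact hmem j hj hji

/-- Straightening: if `T` is not prefix-closed, some form outside `T` is a combination of forms with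
smaller indices in `T`; substituting it replaces `T` by sets of the same size and span in which one
element has been exchanged for a larger one. -/
theorem prod_mem_span_prefixClosed (E : Finset ι) {W : Type*} [AddCommGroup W] [Module K W]
    (v : ι → W) (T : Finset ι) (hT : T ⊆ E) :
    ∏ i ∈ E \ T, SymmetricAlgebra.ι K W (v i) ∈
      span K ((fun T' : Finset ι => ∏ i ∈ E \ T', SymmetricAlgebra.ι K W (v i)) ''
        {T' | T' ⊆ E ∧ PrefixClosed K v E T' ∧ rk K v T' = rk K v T ∧ T'.card = T.card}) := by
  -- Exchanging `i` for a larger `e` lowers the number of pairs `i < x` with `i ∈ T` and `x ∈ E`.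
  induction hN : ∑ i ∈ T, {x ∈ E | i < x}.card using Nat.strong_induction_on generalizing T with
  | _ N ih =>
  by_cases hclosed : PrefixClosed K v E T
  · exact subset_span ⟨T, ⟨hT, hclosed, rfl, rfl⟩, rfl⟩
  simp only [PrefixClosed, not_forall] at hclosed
  obtain ⟨e, heE, hspan, heT⟩ := hclosed
  have hset : {i | i ∈ T ∧ i < e} = (({i ∈ T | i < e} : Finset ι) : Set ι) := by
    ext i
    simp
  rw [hset, mem_span_image_finset_iff_exists_fun'] at hspan
  obtain ⟨c, hc⟩ := hspan
  rw [← Finset.mul_prod_erase _ _ (Finset.mem_sdiff.2 ⟨heE, heT⟩), ← hc, map_sum, Finset.sum_mul]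
  refine sum_mem fun i hi => ?_
  rw [map_smul, smul_mul_assoc]
  by_cases hci : c i = 0
  · rw [hci, zero_smul]
    exact zero_mem _
  refine smul_mem _ _ ?_
  obtain ⟨hiT, hie⟩ := Finset.mem_filter.1 hi
  have heTi : e ∉ T.erase i := fun h => heT (Finset.mem_of_mem_erase h)
  have hi' : i ∉ (E \ T).erase e := fun h =>
    (Finset.mem_sdiff.1 (Finset.mem_of_mem_erase h)).2 hiT
  have hcompl : insert i ((E \ T).erase e) = E \ insert e (T.erase i) := by
    ext x
    have := hT hiT
    simp only [Finset.mem_insert, Finset.mem_erase, Finset.mem_sdiff]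
    grind
  rw [← Finset.prod_insert (f := fun i => SymmetricAlgebra.ι K W (v i)) hi', hcompl]
  have hrk : rk K v (insert e (T.erase i)) = rk K v T := by
    rw [rk, span_image_insert_erase v (Finset.filter_subset _ _) hc hi hci, rk]
  have hcard : (insert e (T.erase i)).card = T.card := by
    rw [Finset.card_insert_of_notMem heTi, Finset.card_erase_add_one hiT]
  have hlt : ∑ j ∈ insert e (T.erase i), {x ∈ E | j < x}.card < N := by
    rw [← hN, Finset.sum_insert heTi, ← Finset.add_sum_erase T _ hiT]
    refine Nat.add_lt_add_right (Finset.card_lt_card ?_) _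
    rw [Finset.ssubset_iff_of_subset fun x hx => ?_]
    · exact ⟨e, by simp [heE, hie], by simp⟩
    · rw [Finset.mem_filter] at hx ⊢
      exact ⟨hx.1, hie.trans hx.2⟩
  have hmem := ih _ hlt (insert e (T.erase i))
    (Finset.insert_subset heE ((Finset.erase_subset _ _).trans hT)) rfl
  rwa [hrk, hcard] at hmem

end Products

/-! ### Dimensions of the pieces and matroid rank -/

section Pieces

variable {K V : Type*} [Field K] [AddCommGroup V] [Module K V] {n : ℕ}

open Classical in
theorem finrank_piece (Δ : Fin n → Dual K V) (j k : ℕ) :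
    finrank K (piece Δ j k) =
      ({T | PrefixClosed K Δ Finset.univ T ∧ rk K Δ T = j ∧ T.card = k} :
        Finset (Finset (Fin n))).card := by
  set B : Finset (Finset (Fin n)) :=
    {T | PrefixClosed K Δ Finset.univ T ∧ rk K Δ T = j ∧ T.card = k} with hB
  set f : Finset (Fin n) → SymmetricAlgebra K (Dual K V) := fun T =>
    ∏ i ∈ Finset.univ \ T, SymmetricAlgebra.ι K (Dual K V) (Δ i) with hf
  have hindep : LinearIndepOn K f (B : Set (Finset (Fin n))) := by
    refine (linearIndepOn_prod_prefixClosed Finset.univ Δ).mono fun T hT => ?_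
    have := (Finset.mem_filter.1 hT).2.1
    simpa using this
  have hspan : piece Δ j k = span K (f '' (B : Set (Finset (Fin n)))) := by
    apply le_antisymm
    · rw [piece, span_le]
      rintro _ ⟨S, hj, hk, rfl⟩
      have h := prod_mem_span_prefixClosed (K := K) Finset.univ Δ Sᶜ (Finset.subset_univ _)
      rw [← Finset.compl_eq_univ_sdiff, compl_compl] at h
      refine span_mono (Set.image_mono ?_) h
      rintro T ⟨-, hc, hr, hcard⟩
      simpa [hB] using ⟨hc, hr.trans hj, hcard.trans hk⟩
    · rw [span_le]
      rintro _ ⟨T, hT, rfl⟩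
      obtain ⟨-, hr, hcard⟩ := (Finset.mem_filter.1 hT).2
      refine subset_span ⟨Tᶜ, ?_, ?_, ?_⟩
      · rwa [compl_compl]
      · rwa [compl_compl]
      · rw [hf, prodForms, Finset.compl_eq_univ_sdiff]
  rw [hspan, Set.image_eq_range, finrank_span_eq_card hindep]
  simp

/-- The matroid rank of a set of indices is the dimension of the span of its forms. -/
theorem eRk_matroid {ι W : Type*} [Finite ι] [AddCommGroup W] [Module K W] (v : ι → W)
    (A : Finset ι) : ((matroid K v).eRk (A : Set ι)).toNat = rk K v A := by
  obtain ⟨I, hI⟩ := (matroid K v).exists_isBasis (A : Set ι) (Set.subset_univ _)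
  have hind : LinearIndepOn K v I := hI.indep
  have hspan : span K (v '' (A : Set ι)) = span K (v '' I) := by
    refine le_antisymm (span_le.2 ?_) (span_mono (Set.image_mono hI.subset))
    rintro _ ⟨e, he, rfl⟩
    by_cases heI : e ∈ I
    · exact subset_span ⟨e, heI, rfl⟩
    · by_contra hn
      exact heI (hI.mem_of_insert_indep he (hind.insert hn))
  have : Fintype I := Fintype.ofFinite I
  rw [hI.eRk_eq_encard, rk, hspan, Set.image_eq_range, finrank_span_eq_card hind,
    ← Nat.card_eq_fintype_card, Nat.card_coe_set_eq]
  rfl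

end Pieces

end VectorConfiguration

/-! ### The Tutte polynomial as a sum of dimensions -/

open VectorConfiguration in
theorem tuttePolynomial_matroid_eq_sum {K V : Type*} [Field K] [AddCommGroup V] [Module K V]
    [FiniteDimensional K V] {n : ℕ} (Δ : Fin n → Module.Dual K V) (hΔ : Submodule.span K (Set.range Δ) = ⊤) :
    VectorConfiguration.tuttePolynomial (VectorConfiguration.matroid K Δ) =
        ∑ k ∈ Finset.range (n + 1), ∑ j ∈ Finset.range (k + 1),
          (X 0 - 1) ^ (Module.finrank K V - j) * X 1 ^ (k - j) *
            (Module.finrank K (VectorConfiguration.piece Δ j k) : MvPolynomial (Fin 2) ℤ) := by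
  classical
  have hground : (matroid K Δ).ground_finite.toFinset = Finset.univ := by
    rw [Set.Finite.toFinset_eq_univ]
    rfl
  have hrank : (matroid K Δ).eRank.toNat = Module.finrank K V := by
    have h := eRk_matroid (K := K) Δ Finset.univ
    rw [Finset.coe_univ, rk, Finset.coe_univ, Set.image_univ, hΔ, finrank_top,
      Subspace.dual_finrank_eq] at h
    rw [← h, Matroid.eRank_def]
    rfl
  have hdim : ∀ j k, (Module.finrank K (piece Δ j k) : MvPolynomial (Fin 2) ℤ) =
      ∑ T : Finset (Fin n) with PrefixClosed K Δ Finset.univ T,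
        if j = rk K Δ T ∧ k = T.card then 1 else 0 := by
    intro j k
    rw [finrank_piece, Finset.sum_ite, Finset.filter_filter]
    simp [eq_comm]
  -- With `ℓ` fixed, the weight `(x - 1) ^ (ℓ - r)` depends on the rank only.
  rw [tuttePolynomial, hground, hrank]
  simp only [eRk_matroid]
  rw [sum_powerset_eq_sum_prefixClosed (X 1) Finset.univ Δ
    fun m => (X 0 - 1) ^ (Module.finrank K V - m), Finset.powerset_univ]
  simp only [hdim, Finset.mul_sum]
  rw [Finset.sum_congr rfl fun k _ => Finset.sum_comm, Finset.sum_comm]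
  refine Finset.sum_congr rfl fun T _ => ?_
  have hT : T.card ∈ Finset.range (n + 1) :=
    Finset.mem_range_succ_iff.2 ((Finset.card_le_univ T).trans_eq (Fintype.card_fin n))
  have hr : rk K Δ T ∈ Finset.range (T.card + 1) :=
    Finset.mem_range_succ_iff.2 (rk_le_card K Δ T)
  rw [Finset.sum_eq_single_of_mem _ hT, Finset.sum_eq_single_of_mem _ hr]
  · simp
  · intro j _ hj
    simp [hj]
  · intro k _ hk
    simp [hk]

theorem theorem1 {K V : Type*} [Field K] [AddCommGroup V] [Module K V] [FiniteDimensional K V]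
    {n : ℕ} (Δ : Fin n → Module.Dual K V) (hΔ : Submodule.span K (Set.range Δ) = ⊤) :
    VectorConfiguration.tuttePolynomial (VectorConfiguration.matroid K Δ) =
        ∑ k ∈ Finset.range (n + 1), ∑ j ∈ Finset.range (k + 1),
          (X 0 - 1) ^ (Module.finrank K V - j) * X 1 ^ (k - j) *
            (Module.finrank K (VectorConfiguration.piece Δ j k) : MvPolynomial (Fin 2) ℤ) ∧
      VectorConfiguration.hilbertSeries Δ =
        MvPolynomial.aeval ![1 + X 0, X 1]
          (VectorConfiguration.tuttePolynomial (VectorConfiguration.matroid K Δ)) := by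
  refine ⟨tuttePolynomial_matroid_eq_sum Δ hΔ, ?_⟩
  rw [tuttePolynomial_matroid_eq_sum Δ hΔ, VectorConfiguration.hilbertSeries]
  simp
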